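/- Let $\mathcal H,\mathcal K$ be finite-dimensional complex Hilbert spaces, and let $\mathcal A\subseteq B(\mathcal H)$, $\mathcal B\subseteq B(\mathcal K)$ be $C^*$-subalgebras containing the identity operators. The adjoint $R^*$ of a linear map $R$ between such algebras is taken with respect to the Hilbert–Schmidt inner products $\langle a,b\rangle=\mathrm{Tr}\,a^*b$. Write $\mathcal A^+$ for the set of positive elements of $\mathcal A$. A linear map $R$ is a *unital Schwarz map* if $R(I)=I$ and $R(a^*a)\ge R(a)^*R(a)$ for all $a$. Let $\mathcal S\subseteq\mathcal A$ be a set of density operators (elements $\sigma\in\mathcal A^+$ with $\mathrm{Tr}\,\sigma=1$) and let $T:\mathcal A\to\mathcal B$ be linear. Assume: 1. $\mathcal S$ contains an invertible element $\rho$, and $T(\rho)$ is invertible; 2. $T^*:\mathcal B\to\mathcal A$ and $T_\rho:\mathcal A\to\mathcal B$, $T_\rho(b)=T(\rho)^{-1/2}\,T(\rho^{1/2}b\rho^{1/2})\,T(\rho)^{-1/2}$, are unital Schwarz maps. $T$ is *reversible for $\mathcal S$* if there is a linear map $S:\mathcal B\to\mathcal A$ such that $S^*$ is a unital Schwarz map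 and $S(T(\sigma))=\sigma$ for all $\sigma\in\mathcal S$. Put $\Phi=T^*\circ T_\rho$ and $\tilde\Phi=T_\rho\circ T^*$. Let $\mathcal F_\Phi\subseteq\mathcal A$ and $\mathcal F_{\tilde\Phi}\subseteq\mathcal B$ be their sets of fixed points, let $\mathcal F_\Phi'\cap\mathcal A$ be the set of elements of $\mathcal A$ commuting with every element of $\mathcal F_\Phi$, and let $$\mathcal M_{T^*}=\{a\in\mathcal B:\ T^*(a^*a)=T^*(a)^*T^*(a),\ T^*(aa^*)=T^*(a)T^*(a)^*\}.$$ Then the following are equivalent. (i) $T$ is reversible for $\mathcal S$. (ii) There is a positive invertible element $\rho^B\in\mathcal F_\Phi'\cap\mathcal A$ such that for each $\sigma\in\mathcal S$ there is a positive $\sigma_0^A\in\mathcal F_{\tilde\Phi}$ with $$\sigma=T^*(\sigma_0^A)\,\rho^B,\qquad T(\sigma)=\sigma_0^A\,T(\rho^B).$$ (iii) There is $\rho^B\in\mathcal A^+$ such that for each $\sigma\in\mathcal S$ there is $\sigma_0^A\in\mathcal B^+$ with $$\sigma=T^*(\sigma_0^A)\,\rho^B,\qquad T(\sigma)=\sigma_0^A\,T(\rho^B).$$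 (iv) There is $\rho^B\in\mathcal A^+$ such that each $\sigma\in\mathcal S$ has the form $\sigma=\sigma^A\rho^B$ with $\sigma^A$ a positive element of $T^*(\mathcal M_{T^*})$. -/

import Mathlib

namespace Reversibility

noncomputable section

set_option linter.unusedSectionVars false

/-- The bounded operators on a Hilbert space `H`. -/
abbrev Op (H : Type*) [NormedAddCommGroup H] [InnerProductSpace ℂ H] : Type _ := H →L[ℂ] H

variable {H K : Type*}
  [NormedAddCommGroup H] [InnerProductSpace ℂ H] [FiniteDimensional ℂ H] [CompleteSpace H]
  [NormedAddCommGroup K] [InnerProductSpace ℂ K] [FiniteDimensional ℂ K] [CompleteSpace K]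
  {A : StarSubalgebra ℂ (Op H)} {B : StarSubalgebra ℂ (Op K)}

/-! The algebraic instances on a subalgebra, named so that instance search finds them at once. -/

instance instRing (A : StarSubalgebra ℂ (Op H)) : Ring A := A.toSubalgebra.toRing

instance instSemiring (A : StarSubalgebra ℂ (Op H)) : Semiring A := (instRing A).toSemiring

instance instAddCommGroup (A : StarSubalgebra ℂ (Op H)) : AddCommGroup A :=
  (instRing A).toAddCommGroup

instance instAddCommMonoid (A : StarSubalgebra ℂ (Op H)) : AddCommMonoid A :=
  (instAddCommGroup A).toAddCommMonoid

instance instAlgebra (A : StarSubalgebra ℂ (Op H)) : Algebra ℂ A := A.toSubalgebra.algebra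

instance instModule (A : StarSubalgebra ℂ (Op H)) : Module ℂ A := (instAlgebra A).toModule

/-- The trace that an operator algebra on `H` inherits from `B(H)`. -/
def tr (a : A) : ℂ := LinearMap.trace ℂ H ((a : Op H) : H →ₗ[ℂ] H)

/-- The Hilbert-Schmidt inner product `Tr (a* b)`, conjugate-linear in `a`. -/
def hs (a b : A) : ℂ := tr (star a * b)

/-- An element of the algebra is positive if it is a positive operator. -/
def Pos (a : A) : Prop := 0 ≤ (a : Op H)

/-- Density operators of the algebra. -/
def IsDensity (a : A) : Prop := Pos a ∧ tr a = 1

theorem hs_eq_sum {ι : Type*} [Fintype ι] (e : OrthonormalBasis ι ℂ H) (a b : A) :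
    hs a b = ∑ i, inner ℂ ((a : Op H) (e i)) ((b : Op H) (e i)) := by
  classical
  rw [hs, tr, LinearMap.trace_eq_sum_inner _ e]
  refine Finset.sum_congr rfl fun i _ => ?_
  have h : ((star a * b : A) : Op H) (e i)
      = ContinuousLinearMap.adjoint (a : Op H) ((b : Op H) (e i)) := rfl
  rw [ContinuousLinearMap.coe_coe, h, ContinuousLinearMap.adjoint_inner_right]

theorem hs_self_eq_zero {a : A} (h : hs a a = 0) : a = 0 := by
  classical
  let e := stdOrthonormalBasis ℂ H
  rw [hs_eq_sum e] at h
  have h2 : ∑ i, ‖(a : Op H) (e i)‖ ^ 2 = 0 := by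
    have h3 := congrArg Complex.re h
    simpa [← inner_self_eq_norm_sq (𝕜 := ℂ)] using h3
  have h4 := (Finset.sum_eq_zero_iff_of_nonneg (fun i _ => by positivity)).1 h2
  apply Subtype.ext
  have h5 : ((a : Op H) : H →ₗ[ℂ] H) = 0 := by
    refine e.toBasis.ext fun i => ?_
    simpa using h4 i (Finset.mem_univ i)
  ext x
  exact LinearMap.congr_fun h5 x

/-- The Hilbert-Schmidt inner product is an inner product. -/
theorem exists_hsCore : ∃ c : InnerProductSpace.Core ℂ A, ∀ a b : A, c.inner a b = hs a b := by
  let e := stdOrthonormalBasis ℂ H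
  refine ⟨{ inner := hs
            conj_inner_symm := fun a b => ?_
            re_inner_nonneg := fun a => ?_
            add_left := fun a b c => ?_
            smul_left := fun a b r => ?_
            definite := fun a h => hs_self_eq_zero h }, fun _ _ => rfl⟩
  · simp [hs_eq_sum e]
  · rw [hs_eq_sum e, map_sum]
    exact Finset.sum_nonneg fun i _ => inner_self_nonneg
  · change hs (a + b) c = hs a c + hs b c
    simp [hs_eq_sum e, Finset.sum_add_distrib]
  · change hs (r • a) b = _ * hs a b
    simp [hs_eq_sum e, Finset.mul_sum, mul_comm]

theorem exists_adjoint_of_core {V W : Type*} [AddCommGroup V] [Module ℂ V] [FiniteDimensional ℂ V]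
    [AddCommGroup W] [Module ℂ W] [FiniteDimensional ℂ W]
    (cV : InnerProductSpace.Core ℂ V) (cW : InnerProductSpace.Core ℂ W) (T : V →ₗ[ℂ] W) :
    ∃ R : W →ₗ[ℂ] V, ∀ (w : W) (v : V), cV.inner (R w) v = cW.inner w (T v) := by
  let _ : NormedAddCommGroup V := @InnerProductSpace.Core.toNormedAddCommGroup ℂ V _ _ _ cV
  let _ : InnerProductSpace ℂ V := InnerProductSpace.ofCore cV.toCore
  let _ : NormedAddCommGroup W := @InnerProductSpace.Core.toNormedAddCommGroup ℂ W _ _ _ cW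
  let _ : InnerProductSpace ℂ W := InnerProductSpace.ofCore cW.toCore
  exact ⟨LinearMap.adjoint T, fun w v => LinearMap.adjoint_inner_left T v w⟩

theorem finiteDimensional (A : StarSubalgebra ℂ (Op H)) : FiniteDimensional ℂ A :=
  inferInstanceAs (FiniteDimensional ℂ (Subalgebra.toSubmodule A.toSubalgebra))

theorem exists_hsAdjoint (T : A →ₗ[ℂ] B) :
    ∃ R : B →ₗ[ℂ] A, ∀ (b : B) (a : A), hs (R b) a = hs b (T a) := by
  obtain ⟨cA, hA⟩ := exists_hsCore (A := A)
  obtain ⟨cB, hB⟩ := exists_hsCore (A := B)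
  have := finiteDimensional A
  have := finiteDimensional B
  obtain ⟨R, hR⟩ := exists_adjoint_of_core cA cB T
  exact ⟨R, fun b a => by rw [← hA, ← hB]; exact hR b a⟩

/-- The adjoint `T*` of `T` with respect to the Hilbert-Schmidt inner products. -/
def hsAdjoint (T : A →ₗ[ℂ] B) : B →ₗ[ℂ] A := (exists_hsAdjoint T).choose

theorem hs_hsAdjoint (T : A →ₗ[ℂ] B) (b : B) (a : A) : hs (hsAdjoint T b) a = hs b (T a) :=
  (exists_hsAdjoint T).choose_spec b a

/-- The adjoint is determined by its defining identity. -/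
theorem hsAdjoint_unique (T : A →ₗ[ℂ] B) (R : B →ₗ[ℂ] A)
    (h : ∀ (b : B) (a : A), hs (R b) a = hs b (T a)) : R = hsAdjoint T := by
  refine LinearMap.ext fun b => sub_eq_zero.1 (hs_self_eq_zero ?_)
  have e := stdOrthonormalBasis ℂ H
  have h2 : ∀ x y z : A, hs (x - y) z = hs x z - hs y z := fun x y z => by
    simp [hs_eq_sum e, Finset.sum_sub_distrib]
  rw [h2, h, hs_hsAdjoint, sub_self]

/-- The Schwarz inequality `Φ(a* a) ≥ Φ(a)* Φ(a)`. -/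
def IsSchwarz (Φ : A →ₗ[ℂ] B) : Prop := ∀ a : A, Pos (Φ (star a * a) - star (Φ a) * Φ a)

/-- Unital Schwarz maps. -/
def IsUnitalSchwarz (Φ : A →ₗ[ℂ] B) : Prop := Φ 1 = 1 ∧ IsSchwarz Φ

theorem rpow_mem (a : A) (r : ℝ) : ((a : Op H) ^ r) ∈ A := by
  have hcl : IsClosed (A : Set (Op H)) :=
    Submodule.closed_of_finiteDimensional (Subalgebra.toSubmodule A.toSubalgebra)
  rw [CFC.rpow_def]
  by_cases ha : 0 ≤ (a : Op H)
  · rw [cfc_nnreal_eq_real _ _ ha]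
    exact cfc_mem (𝕜 := ℝ) (𝕜' := ℂ) _ a.2
  · rw [cfc_apply_of_not_predicate _ ha]
    exact zero_mem A

/-- The real power `a ^ r` of a positive element `a`, by functional calculus. -/
def rpow (a : A) (r : ℝ) : A := ⟨(a : Op H) ^ r, rpow_mem a r⟩

/-- The map `b ↦ T(ρ)^{-1/2} T(ρ^{1/2} b ρ^{1/2}) T(ρ)^{-1/2}`, for positive `ρ`
such that `ρ` and `T(ρ)` are invertible. -/
def dualMap (T : A →ₗ[ℂ] B) (ρ : A) : A →ₗ[ℂ] B :=
  LinearMap.mulLeftRight ℂ (rpow (T ρ) (-1 / 2), rpow (T ρ) (-1 / 2)) ∘ₗ T ∘ₗ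
    LinearMap.mulLeftRight ℂ (rpow ρ (1 / 2), rpow ρ (1 / 2))

/-- The multiplicative domain of a map. -/
def multDomain (Φ : A →ₗ[ℂ] B) : Set A :=
  {a | Φ (star a * a) = star (Φ a) * Φ a ∧ Φ (a * star a) = Φ a * star (Φ a)}

/-- The set of fixed points of a map. -/
def fixedPoints (Φ : A →ₗ[ℂ] A) : Set A := {a | Φ a = a}

/-- `T` is reversible for the set `𝒮`: some `S`, whose adjoint is a unital Schwarz map,
recovers every element of `𝒮` from its image under `T`. -/
def IsReversible (T : A →ₗ[ℂ] B) (𝒮 : Set A) : Prop :=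
  ∃ S : B →ₗ[ℂ] A, IsUnitalSchwarz (hsAdjoint S) ∧ ∀ σ ∈ 𝒮, S (T σ) = σ

end

end Reversibility

namespace Reversibility

noncomputable section

set_option linter.unusedSectionVars false

open scoped ComplexOrder

variable {H K : Type*}
  [NormedAddCommGroup H] [InnerProductSpace ℂ H] [FiniteDimensional ℂ H] [CompleteSpace H]
  [NormedAddCommGroup K] [InnerProductSpace ℂ K] [FiniteDimensional ℂ K] [CompleteSpace K]
  {A : StarSubalgebra ℂ (Op H)} {B : StarSubalgebra ℂ (Op K)}

/-! ### Trace and positivity in an operator algebra -/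

/-! Suppose `S` reverses `T` on `𝒮`. Then Ψ = T*∘S* is a unital Schwarz map, every σ in `𝒮` is
Ψ-invariant, and ρ is a faithful invariant density. Faithfulness turns the Schwarz inequality into
an equality at fixed points, so these form a *-algebra F, and σ is invariant exactly when σρ⁻¹ lies
in F. If h in F represents Tr(ρ ·) on F, then ρB = h⁻¹ρ commutes with F and σ = (σρ⁻¹h)ρB
(`exists_factorization`). For positive f in F, S*(f) lies in the multiplicative domain of T*, which
carries the factorization over to Tσ (`exists_factorization_of_reverses`).

Conversely, a joint factorization of σ and Tσ forces its factor into the multiplicative domain of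
T*. The square roots of ρ and Tρ then factor in the same way, and cancelling them shows that the
adjoint of T_ρ, a Petz-type recovery map, reverses `T` (`hsAdjoint_dualMap_apply`). With this choice
of `S`, Ψ is Φ, which gives (ii). For (iv), the identity T(T*(c)x) = cT(x) on the multiplicative
domain and the faithfulness of T* recover (iii). -/

theorem tr_add (a b : A) : tr (a + b) = tr a + tr b := by simp [tr]

theorem tr_sub (a b : A) : tr (a - b) = tr a - tr b := by simp [tr]

theorem tr_zero : tr (0 : A) = 0 := by simp [tr]

theorem tr_smul (c : ℂ) (a : A) : tr (c • a) = c * tr a := by simp [tr]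

theorem tr_mul_comm (a b : A) : tr (a * b) = tr (b * a) :=
  LinearMap.trace_mul_comm ℂ ((a : Op H) : H →ₗ[ℂ] H) ((b : Op H) : H →ₗ[ℂ] H)

theorem tr_star (a : A) : tr (star a) = star (tr a) := by
  obtain ⟨c, hc⟩ := exists_hsCore (A := A)
  have h := c.conj_inner_symm a 1
  rw [hc, hc] at h
  simpa [hs] using h.symm

theorem hs_self_nonneg (a : A) : 0 ≤ hs a a := by
  rw [hs_eq_sum (stdOrthonormalBasis ℂ H)]
  exact Finset.sum_nonneg fun i _ => by
    rw [inner_self_eq_norm_sq_to_K]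
    exact pow_nonneg (Complex.zero_le_real.2
      (norm_nonneg ((a : Op H) (stdOrthonormalBasis ℂ H i)))) 2

theorem eq_of_hs {a b : A} (h : ∀ x : A, hs x a = hs x b) : a = b := by
  refine sub_eq_zero.1 (hs_self_eq_zero ?_)
  have h1 := h (a - b)
  unfold hs at h1 ⊢
  rw [mul_sub, tr_sub, h1, sub_self]

theorem Pos.star_eq {a : A} (h : Pos a) : star a = a :=
  Subtype.ext (IsSelfAdjoint.of_nonneg h)

theorem pos_star_mul_self (a : A) : Pos (star a * a) := star_mul_self_nonneg (a : Op H)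

theorem Pos.add {a b : A} (ha : Pos a) (hb : Pos b) : Pos (a + b) := add_nonneg ha hb

theorem Pos.eq_zero {a : A} (ha : Pos a) (hb : Pos (-a)) : a = 0 := by
  refine Subtype.ext (le_antisymm ?_ ha)
  exact neg_nonneg.1 hb

theorem Pos.mul {a b : A} (ha : Pos a) (hb : Pos b) (hab : a * b = b * a) : Pos (a * b) :=
  Commute.mul_nonneg ha hb (congrArg Subtype.val hab)

theorem pos_rpow (a : A) (r : ℝ) : Pos (rpow a r) := CFC.rpow_nonneg

theorem rpow_half_mul_self {a : A} (ha : Pos a) : rpow a (1 / 2) * rpow a (1 / 2) = a := by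
  refine Subtype.ext ?_
  change (a : Op H) ^ (1 / 2 : ℝ) * (a : Op H) ^ (1 / 2 : ℝ) = a
  rw [← CFC.sqrt_eq_rpow]
  exact CFC.sqrt_mul_sqrt_self _ ha

/-- Uniqueness of the positive square root. -/
theorem eq_rpow_half {a b : A} (h : b * b = a) (hb : Pos b) : b = rpow a (1 / 2) := by
  refine Subtype.ext ?_
  change (b : Op H) = (a : Op H) ^ (1 / 2 : ℝ)
  rw [← CFC.sqrt_eq_rpow]
  exact (CFC.sqrt_unique (congrArg Subtype.val h) hb).symm

theorem rpow_neg_half_mul {a : A} (ha : Pos a) (hu : IsUnit a) :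
    rpow a (-1 / 2) * rpow a (1 / 2) = 1 := by
  refine Subtype.ext ?_
  change (a : Op H) ^ (-1 / 2 : ℝ) * (a : Op H) ^ (1 / 2 : ℝ) = 1
  rw [neg_div]
  exact CFC.rpow_neg_mul_rpow (1 / 2) (IsUnit.isStrictlyPositive (hu.map A.subtype) ha)

theorem mul_rpow_neg_half {a : A} (ha : Pos a) (hu : IsUnit a) :
    rpow a (1 / 2) * rpow a (-1 / 2) = 1 := by
  refine Subtype.ext ?_
  change (a : Op H) ^ (1 / 2 : ℝ) * (a : Op H) ^ (-1 / 2 : ℝ) = 1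
  rw [neg_div]
  exact CFC.rpow_mul_rpow_neg (1 / 2) (IsUnit.isStrictlyPositive (hu.map A.subtype) ha)

theorem rpow_half_commute {a b : A} (h : a * b = b * a) :
    rpow a (1 / 2) * b = b * rpow a (1 / 2) := by
  refine Subtype.ext ?_
  change (a : Op H) ^ (1 / 2 : ℝ) * (b : Op H) = b * (a : Op H) ^ (1 / 2 : ℝ)
  rw [CFC.rpow_def]
  exact Commute.cfc_nnreal (congrArg Subtype.val h : (a : Op H) * b = b * a) _

/-- The trace pairing of positive elements as a Hilbert-Schmidt square. -/
theorem Pos.tr_mul_eq {p r : A} (hp : Pos p) (hr : Pos r) :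
    tr (p * r) = hs (rpow p (1 / 2) * rpow r (1 / 2)) (rpow p (1 / 2) * rpow r (1 / 2)) := by
  have hq := rpow_half_mul_self hp
  have hs' := rpow_half_mul_self hr
  have hq' := (pos_rpow p (1 / 2)).star_eq
  have hs'' := (pos_rpow r (1 / 2)).star_eq
  generalize rpow p (1 / 2) = q at *
  generalize rpow r (1 / 2) = s at *
  rw [hs, star_mul, hq', hs'', ← hq, ← hs', mul_assoc s, tr_mul_comm s]
  simp only [mul_assoc]

theorem Pos.tr_mul_nonneg {p r : A} (hp : Pos p) (hr : Pos r) : 0 ≤ tr (p * r) := by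
  rw [hp.tr_mul_eq hr]
  exact hs_self_nonneg _

theorem Pos.eq_zero_of_tr_mul {p r : A} (hp : Pos p) (hr : Pos r) (hu : IsUnit r)
    (h : tr (p * r) = 0) : p = 0 := by
  rw [hp.tr_mul_eq hr] at h
  have h1 := hs_self_eq_zero h
  have h2 : rpow p (1 / 2) * r = 0 := by
    rw [← rpow_half_mul_self hr, ← mul_assoc, h1, zero_mul]
  rw [← rpow_half_mul_self hp, hu.mul_left_eq_zero.1 h2, zero_mul]

/-- The cone of positive elements is self-dual. -/
theorem pos_of_tr_mul_nonneg {x : A} (hx : star x = x) (h : ∀ p : A, Pos p → 0 ≤ tr (p * x)) :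
    Pos x := by
  have hsa : IsSelfAdjoint (x : Op H) := congrArg Subtype.val hx
  have : IsClosed (A : Set (Op H)) :=
    Submodule.closed_of_finiteDimensional (Subalgebra.toSubmodule A.toSubalgebra)
  have hmem : (x : Op H)⁻ ∈ A := by
    rw [CFC.negPart_def]
    exact cfcₙ_mem (𝕜 := ℝ) (𝕜' := ℂ) _ x.2
  -- Testing against the negative part `n` of `x` gives `-tr (n * n)`, which is nonnegative only if
  -- `n = 0`.
  let n : A := ⟨(x : Op H)⁻, hmem⟩
  have hn : Pos n := CFC.negPart_nonneg _
  have hnx : n * x = -(n * n) := by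
    refine Subtype.ext ?_
    change (x : Op H)⁻ * (x : Op H) = -((x : Op H)⁻ * (x : Op H)⁻)
    have h1 : (x : Op H) = (x : Op H)⁺ - (x : Op H)⁻ := (CFC.posPart_sub_negPart _ hsa).symm
    calc (x : Op H)⁻ * (x : Op H) = (x : Op H)⁻ * ((x : Op H)⁺ - (x : Op H)⁻) := by rw [← h1]
      _ = _ := by rw [mul_sub, CFC.negPart_mul_posPart, zero_sub]
  have h1 := h n hn
  have h2 : hs n n = 0 := by
    refine le_antisymm ?_ (hs_self_nonneg n)
    rw [hs, hn.star_eq]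
    have : tr (n * x) = - tr (n * n) := by rw [hnx, ← zero_sub, tr_sub, tr_zero, zero_sub]
    rw [this] at h1
    exact neg_nonneg.1 h1
  have h3 : (x : Op H)⁻ = 0 := congrArg Subtype.val (hs_self_eq_zero h2)
  have h4 : (0 : Op H) ≤ (x : Op H)⁺ - (x : Op H)⁻ := by
    rw [h3, sub_zero]
    exact CFC.posPart_nonneg _
  rwa [CFC.posPart_sub_negPart (x : Op H) hsa] at h4

/-! ### Schwarz maps and multiplicative domains -/

/-- Polarization: the images of `(1 + a)* (1 + a)` and `(1 + i a)* (1 + i a)` are self-adjoint,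
which controls the sum and the difference of `Φ (star a)` and `Φ a`. -/
theorem map_star_of_pos {Φ : A →ₗ[ℂ] B} (h : ∀ p, Pos p → Pos (Φ p)) (a : A) :
    Φ (star a) = star (Φ a) := by
  have h0 := (h _ (pos_star_mul_self (1 : A))).star_eq
  have h1 := (h _ (pos_star_mul_self a)).star_eq
  have h2 := (h _ (pos_star_mul_self (1 + a))).star_eq
  have h3 := (h _ (pos_star_mul_self (1 + Complex.I • a))).star_eq
  have e2 : star (1 + a) * (1 + a) = star 1 * 1 + a + star a + star a * a := by
    simp only [star_add, star_one]; noncomm_ring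
  have e3 : star (1 + Complex.I • a) * (1 + Complex.I • a)
      = star 1 * 1 + Complex.I • a - Complex.I • star a + star a * a := by
    simp only [star_add, star_one, star_smul, add_mul, mul_add, smul_mul_smul_comm, one_mul,
      mul_one, Complex.star_def, Complex.conj_I, neg_smul, neg_mul, Complex.I_mul_I, neg_neg,
      one_smul]
    abel
  rw [e2] at h2
  rw [e3] at h3
  simp only [map_add, map_sub, map_smul, star_add, star_sub, star_smul, Complex.star_def,
    Complex.conj_I, neg_smul, h0, h1] at h2 h3
  have h4 : Φ (star a) + Φ a = star (Φ (star a)) + star (Φ a) := by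
    have := congrArg (fun z => z - Φ (star 1 * 1) - Φ (star a * a)) h2
    rw [add_comm (Φ (star a)), add_comm (star (Φ (star a)))]
    calc Φ a + Φ (star a) = _ := by abel
      _ = _ := this.symm
      _ = _ := by abel
  have h5 : Complex.I • (Φ (star a) - Φ a) = Complex.I • (star (Φ a) - star (Φ (star a))) := by
    have := congrArg (fun z => Φ (star 1 * 1) + Φ (star a * a) - z) h3
    rw [smul_sub, smul_sub]
    calc _ = _ := by abel
      _ = _ := this.symm
      _ = _ := by abel
  have h6 := smul_right_injective B Complex.I_ne_zero h5
  have h7 : (2 : ℂ) • Φ (star a) = (2 : ℂ) • star (Φ a) := by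
    have := congrArg₂ (· + ·) h4 h6
    rw [two_smul, two_smul]
    calc _ = _ := by abel
      _ = _ := this
      _ = _ := by abel
  exact smul_right_injective B two_ne_zero h7

/-- A map with positive adjoint is positive. -/
theorem pos_of_hsAdjoint_pos {T : A →ₗ[ℂ] B} (h : ∀ p, Pos p → Pos (hsAdjoint T p)) (a : A)
    (ha : Pos a) : Pos (T a) := by
  refine pos_of_tr_mul_nonneg (eq_of_hs fun b => ?_) fun p hp => ?_
  · calc hs b (star (T a)) = star (hs (star b) (T a)) := by
          rw [hs, hs, ← tr_star, star_mul, tr_mul_comm, star_star]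
      _ = star (hs (hsAdjoint T (star b)) a) := by rw [hs_hsAdjoint]
      _ = hs (hsAdjoint T b) (star a) := by
          rw [hs, hs, ← tr_star, star_mul, tr_mul_comm, map_star_of_pos h, star_star]
      _ = hs b (T a) := by rw [ha.star_eq, hs_hsAdjoint]
  · have := (h p hp).tr_mul_nonneg ha
    rwa [← (h p hp).star_eq, ← hs, hs_hsAdjoint, hs, hp.star_eq] at this

/-- Paired with a positive `p`, the hypothesis says that an affine function of `t` is nonnegative on
the whole line, so its slope `tr (p * Y)` vanishes. By self-duality of the cone both `Y` and `-Y`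
are positive. -/
theorem eq_zero_of_pos_add_smul {P Y : A} (hY : star Y = Y)
    (h : ∀ t : ℝ, Pos (P + (t : ℂ) • Y)) : Y = 0 := by
  have key : ∀ p : A, Pos p → tr (p * Y) = 0 := by
    intro p hp
    have h1 : ∀ t : ℝ, 0 ≤ tr (p * P) + t * tr (p * Y) := fun t => by
      have := hp.tr_mul_nonneg (h t)
      rwa [mul_add, mul_smul_comm, tr_add, tr_smul] at this
    have hre : ∀ t : ℝ, 0 ≤ (tr (p * P)).re + t * (tr (p * Y)).re := fun t => by
      simpa using (Complex.le_def.1 (h1 t)).1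
    have him : ∀ t : ℝ, 0 = (tr (p * P)).im + t * (tr (p * Y)).im := fun t => by
      simpa using (Complex.le_def.1 (h1 t)).2
    refine Complex.ext ?_ ?_
    · by_contra hne
      -- At this `t` the affine function takes the value -1.
      have := hre (-((tr (p * P)).re + 1) / (tr (p * Y)).re)
      rw [div_mul_cancel₀ _ hne] at this
      linarith
    · have h2 := him 0
      have h3 := him 1
      simp only [Complex.zero_im]
      linarith
  refine Pos.eq_zero (pos_of_tr_mul_nonneg hY fun p hp => (key p hp).ge)
    (pos_of_tr_mul_nonneg (by rw [star_neg, hY]) fun p hp => ?_)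
  rw [mul_neg, ← zero_sub, tr_sub, key p hp, tr_zero, sub_zero]

namespace IsSchwarz

variable {Φ : A →ₗ[ℂ] B}

theorem pos (hΦ : IsSchwarz Φ) (p : A) (hp : Pos p) : Pos (Φ p) := by
  have h := (hΦ (rpow p (1 / 2))).add (pos_star_mul_self (Φ (rpow p (1 / 2))))
  rwa [sub_add_cancel, (pos_rpow _ _).star_eq, rpow_half_mul_self hp] at h

theorem map_star (hΦ : IsSchwarz Φ) (a : A) : Φ (star a) = star (Φ a) :=
  map_star_of_pos hΦ.pos a

/-- The Schwarz defect at `b + c a` has no quadratic term in `c`, because the defect at `a` is zero.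
Its linear part must therefore vanish; real and imaginary `c` together kill `X`. -/
theorem map_star_mul (hΦ : IsSchwarz Φ) {a : A} (ha : Φ (star a * a) = star (Φ a) * Φ a) (b : A) :
    Φ (star b * a) = star (Φ b) * Φ a := by
  set X := Φ (star b * a) - star (Φ b) * Φ a with hX
  have hX' : star X = Φ (star a * b) - star (Φ a) * Φ b := by
    rw [hX, star_sub, ← hΦ.map_star, star_mul, star_star, star_mul, star_star]
  have h : ∀ c : ℂ, Pos ((Φ (star b * b) - star (Φ b) * Φ b) + (c • X + star c • star X)) := by
    intro c
    have h1 := hΦ (b + c • a)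
    convert h1 using 1
    rw [hX', hX]
    simp only [star_add, star_smul, map_add, map_smul, add_mul, mul_add, smul_mul_assoc,
      mul_smul_comm, smul_sub, smul_add, ha]
    abel
  have h1 : X + star X = 0 := by
    refine eq_zero_of_pos_add_smul (P := Φ (star b * b) - star (Φ b) * Φ b)
      (by rw [star_add, star_star, add_comm]) fun t => ?_
    convert h t using 2
    rw [smul_add, Complex.star_def, Complex.conj_ofReal]
  have h2 : Complex.I • X - Complex.I • star X = 0 := by
    refine eq_zero_of_pos_add_smul (P := Φ (star b * b) - star (Φ b) * Φ b) ?_ fun t => ?_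
    · rw [star_sub, star_smul, star_smul, star_star, Complex.star_def, Complex.conj_I, neg_smul,
        neg_smul]
      abel
    · convert h (t * Complex.I) using 2
      rw [smul_sub, smul_smul, smul_smul, Complex.star_def, map_mul, Complex.conj_ofReal,
        Complex.conj_I, mul_neg, neg_smul, sub_eq_add_neg]
  rw [← smul_sub] at h2
  have h3 : X - star X = 0 := by
    simpa using h2
  have h4 : (2 : ℂ) • X = 0 := by
    rw [two_smul]
    calc X + X = (X + star X) + (X - star X) := by abel
      _ = 0 := by rw [h1, h3, add_zero]
  have h5 : X = 0 := by simpa using h4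
  exact sub_eq_zero.1 h5

theorem mem_multDomain_iff (hΦ : IsSchwarz Φ) {a : A} :
    a ∈ multDomain Φ ↔ (∀ b, Φ (b * a) = Φ b * Φ a) ∧ ∀ b, Φ (a * b) = Φ a * Φ b := by
  refine ⟨fun h => ⟨fun b => ?_, fun b => ?_⟩, fun h => ⟨?_, ?_⟩⟩
  · have := hΦ.map_star_mul h.1 (star b)
    rwa [star_star, hΦ.map_star, star_star] at this
  · have h1 : Φ (star (star a) * star a) = star (Φ (star a)) * Φ (star a) := by
      rw [star_star, h.2, hΦ.map_star, star_star]
    have := congrArg star (hΦ.map_star_mul h1 b)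
    rwa [← hΦ.map_star, star_mul, star_star, star_star, star_mul, hΦ.map_star, star_star,
      star_star] at this
  · rw [h.1, hΦ.map_star]
  · rw [h.2, hΦ.map_star]

end IsSchwarz

/-- A unital star-closed subalgebra of `A`, as an operator algebra. -/
def toStarSubalgebra (S : Set A) (h1 : 1 ∈ S) (hmul : ∀ a ∈ S, ∀ b ∈ S, a * b ∈ S)
    (hadd : ∀ a ∈ S, ∀ b ∈ S, a + b ∈ S) (hsmul : ∀ c : ℂ, ∀ a ∈ S, c • a ∈ S)
    (hstar : ∀ a ∈ S, star a ∈ S) : StarSubalgebra ℂ (Op H) where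
  carrier := Subtype.val '' S
  mul_mem' := by
    rintro _ _ ⟨a, ha, rfl⟩ ⟨b, hb, rfl⟩
    exact ⟨a * b, hmul a ha b hb, rfl⟩
  add_mem' := by
    rintro _ _ ⟨a, ha, rfl⟩ ⟨b, hb, rfl⟩
    exact ⟨a + b, hadd a ha b hb, rfl⟩
  algebraMap_mem' c := ⟨c • 1, hsmul c 1 h1, (Algebra.algebraMap_eq_smul_one c).symm⟩
  star_mem' := by
    rintro _ ⟨a, ha, rfl⟩
    exact ⟨star a, hstar a ha, rfl⟩

theorem mem_toStarSubalgebra {S : Set A} {h1 hmul hadd hsmul hstar} {a : A} :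
    (a : Op H) ∈ toStarSubalgebra S h1 hmul hadd hsmul hstar ↔ a ∈ S :=
  ⟨fun ⟨_, hb, h⟩ => Subtype.ext h ▸ hb, fun h => ⟨a, h, rfl⟩⟩

namespace IsUnitalSchwarz

variable {Φ : A →ₗ[ℂ] B}

/-- The multiplicative domain of a unital Schwarz map, as an operator algebra. -/
def multDomainAlgebra (hΦ : IsUnitalSchwarz Φ) : StarSubalgebra ℂ (Op H) :=
  have h := fun x : A => hΦ.2.mem_multDomain_iff (a := x)
  toStarSubalgebra (multDomain Φ) ((h 1).2 (by simp [hΦ.1]))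
    (fun a ha b hb => (h _).2 ⟨fun x => by
      rw [((h b).1 hb).1, ← mul_assoc, ((h b).1 hb).1, ((h a).1 ha).1, mul_assoc], fun x => by
      rw [((h b).1 hb).1, mul_assoc, ((h a).1 ha).2, ((h b).1 hb).2, mul_assoc]⟩)
    (fun a ha b hb => (h _).2 ⟨fun x => by
      simp [mul_add, ((h a).1 ha).1, ((h b).1 hb).1], fun x => by
      simp [add_mul, ((h a).1 ha).2, ((h b).1 hb).2]⟩)
    (fun c a ha => (h _).2 ⟨fun x => by simp [((h a).1 ha).1], fun x => by
      simp [((h a).1 ha).2]⟩)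
    (fun a ha => by
      refine ⟨?_, ?_⟩
      · rw [star_star, ha.2, hΦ.2.map_star, star_star]
      · rw [star_star, ha.1, hΦ.2.map_star, star_star])

theorem mem_multDomainAlgebra (hΦ : IsUnitalSchwarz Φ) {a : A} :
    (a : Op H) ∈ hΦ.multDomainAlgebra ↔ a ∈ multDomain Φ :=
  ⟨fun ⟨_, hb, h⟩ => Subtype.ext h ▸ hb, fun h => ⟨a, h, rfl⟩⟩

theorem mul_mem_multDomain (hΦ : IsUnitalSchwarz Φ) {a b : A} (ha : a ∈ multDomain Φ)
    (hb : b ∈ multDomain Φ) : a * b ∈ multDomain Φ :=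
  hΦ.mem_multDomainAlgebra.1
    (mul_mem (hΦ.mem_multDomainAlgebra.2 ha) (hΦ.mem_multDomainAlgebra.2 hb))

theorem sub_mem_multDomain (hΦ : IsUnitalSchwarz Φ) {a b : A} (ha : a ∈ multDomain Φ)
    (hb : b ∈ multDomain Φ) : a - b ∈ multDomain Φ :=
  hΦ.mem_multDomainAlgebra.1
    (sub_mem (hΦ.mem_multDomainAlgebra.2 ha) (hΦ.mem_multDomainAlgebra.2 hb))

theorem star_mem_multDomain (hΦ : IsUnitalSchwarz Φ) {a : A} (ha : a ∈ multDomain Φ) :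
    star a ∈ multDomain Φ :=
  hΦ.mem_multDomainAlgebra.1 (star_mem (hΦ.mem_multDomainAlgebra.2 ha))

/-- The multiplicative domain is itself an operator algebra on `H`, so functional calculus in B(H)
stays inside it. -/
theorem rpow_mem_multDomain (hΦ : IsUnitalSchwarz Φ) {a : A} (ha : a ∈ multDomain Φ) (r : ℝ) :
    rpow a r ∈ multDomain Φ :=
  hΦ.mem_multDomainAlgebra.1
    (rpow_mem (⟨a, hΦ.mem_multDomainAlgebra.2 ha⟩ : hΦ.multDomainAlgebra) r)

/-- Positive elements of the multiplicative domain of a faithful map are those with positive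
image. -/
theorem pos_of_pos_map (hΦ : IsUnitalSchwarz Φ) (hf : ∀ p, Pos p → Φ p = 0 → p = 0) {c : A}
    (hc : c ∈ multDomain Φ) (hpos : Pos (Φ c)) : Pos c := by
  have hinj : ∀ x ∈ multDomain Φ, Φ x = 0 → x = 0 := fun x hx h0 => by
    have h1 := hf _ (pos_star_mul_self x) (by rw [hx.1, h0, mul_zero])
    exact hs_self_eq_zero (by rw [hs, h1, tr_zero])
  have hsa : star c = c := by
    refine sub_eq_zero.1 (hinj _ (hΦ.sub_mem_multDomain (hΦ.star_mem_multDomain hc) hc) ?_)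
    rw [map_sub, hΦ.2.map_star, hpos.star_eq, sub_self]
  have hcc : Pos (c * c) := by
    have := pos_star_mul_self c
    rwa [hsa] at this
  have hn : rpow (c * c) (1 / 2) ∈ multDomain Φ :=
    hΦ.rpow_mem_multDomain (hΦ.mul_mem_multDomain hc hc) _
  -- Both sides are positive square roots of `Φ (c * c)`; injectivity on the multiplicative domain
  -- then identifies `c` with its absolute value.
  have h1 : Φ (rpow (c * c) (1 / 2)) = Φ c := by
    rw [eq_rpow_half (a := Φ (c * c)) _ hpos]
    · refine eq_rpow_half ?_ (hΦ.2.pos _ (pos_rpow _ _))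
      rw [← (hΦ.2.mem_multDomain_iff.1 hn).1, rpow_half_mul_self hcc]
    · rw [← (hΦ.2.mem_multDomain_iff.1 hc).1]
  have h2 : rpow (c * c) (1 / 2) = c :=
    sub_eq_zero.1 (hinj _ (hΦ.sub_mem_multDomain hn hc) (by rw [map_sub, h1, sub_self]))
  rw [← h2]
  exact pos_rpow _ _

end IsUnitalSchwarz

/-! ### Factorization of invariant elements of a Schwarz map -/

theorem hsAdjoint_hsAdjoint (T : A →ₗ[ℂ] B) : hsAdjoint (hsAdjoint T) = T := by
  refine (hsAdjoint_unique _ _ fun a b => ?_).symm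
  have h := congrArg star (hs_hsAdjoint T b a)
  rw [hs, hs, ← tr_star, ← tr_star, star_mul, star_mul, star_star, star_star] at h
  exact h.symm

theorem Pos.inv {h k : A} (hh : Pos h) (hk : h * k = 1) : Pos k := by
  have hs' : star k = k := by
    have h1 : star k * h = 1 := by rw [← hh.star_eq, ← star_mul, hk, star_one]
    calc star k = star k * (h * k) := by rw [hk, mul_one]
      _ = k := by rw [← mul_assoc, h1, one_mul]
  have h2 := pos_star_mul_self (rpow h (1 / 2) * k)
  rwa [star_mul, hs', (pos_rpow _ _).star_eq, mul_assoc, ← mul_assoc (rpow h (1 / 2)),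
    rpow_half_mul_self hh, hk, mul_one] at h2

/-- The functional `Tr (· σ)` is invariant under `Ψ`. -/
def IsInvariant (Ψ : A →ₗ[ℂ] A) (σ : A) : Prop := ∀ a, tr (Ψ a * σ) = tr (a * σ)

theorem isInvariant_of_hs {Ψ : A →ₗ[ℂ] A} (hΨ : IsSchwarz Ψ) {σ : A}
    (h : ∀ a, hs (Ψ a) σ = hs a σ) : IsInvariant Ψ σ := fun a => by
  have := h (star a)
  rwa [hs, hs, hΨ.map_star, star_star, star_star] at this

theorem IsInvariant.star {Ψ : A →ₗ[ℂ] A} (hΨ : IsSchwarz Ψ) {σ : A} (h : IsInvariant Ψ σ) :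
    IsInvariant Ψ (star σ) := fun a => by
  have := congrArg Star.star (h (Star.star a))
  rwa [← tr_star, ← tr_star, star_mul, star_mul, hΨ.map_star, star_star, star_star,
    tr_mul_comm, tr_mul_comm (Star.star σ)] at this

section Factorization

variable {Ψ : A →ₗ[ℂ] A} {ρ : A}

/-- At a fixed point the Schwarz defect has zero trace against ρ by invariance, and ρ is faithful.
-/
theorem mem_multDomain_of_fixed (hΨ : IsSchwarz Ψ) (hρ : Pos ρ) (hu : IsUnit ρ)
    (hinv : IsInvariant Ψ ρ) {f : A} (hf : Ψ f = f) : f ∈ multDomain Ψ := by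
  have key : ∀ g : A, Ψ g = g → Ψ (star g * g) = star (Ψ g) * Ψ g := fun g hg => by
    refine sub_eq_zero.1 ((hΨ g).eq_zero_of_tr_mul hρ hu ?_)
    rw [sub_mul, tr_sub, hinv, hg, sub_self]
  refine ⟨key f hf, ?_⟩
  have := key (star f) (by rw [hΨ.map_star, hf])
  rwa [hΨ.map_star, star_star, star_star] at this

theorem map_mul_of_fixed (hΨ : IsSchwarz Ψ) (hρ : Pos ρ) (hu : IsUnit ρ)
    (hinv : IsInvariant Ψ ρ) {f : A} (hf : Ψ f = f) (a : A) : Ψ (a * f) = Ψ a * f := by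
  rw [(hΨ.mem_multDomain_iff.1 (mem_multDomain_of_fixed hΨ hρ hu hinv hf)).1, hf]

theorem isInvariant_of_fixed (hΨ : IsSchwarz Ψ) (hρ : Pos ρ) (hu : IsUnit ρ)
    (hinv : IsInvariant Ψ ρ) {f : A} (hf : Ψ f = f) : IsInvariant Ψ (f * ρ) := fun a => by
  rw [← mul_assoc, ← mul_assoc, ← map_mul_of_fixed hΨ hρ hu hinv hf, hinv]

/-- Invariance evaluates the cross terms of `tr ((Ψ g - g)* (Ψ g - g) ρ)`; what remains is minus the
trace of the Schwarz defect. The quantity is thus both nonnegative and nonpositive. -/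
theorem fixed_of_isInvariant (hΨ : IsSchwarz Ψ) (hρ : Pos ρ) (hu : IsUnit ρ)
    (hinv : IsInvariant Ψ ρ) {g : A} (hg : IsInvariant Ψ (g * ρ)) : Ψ g = g := by
  have h1 : tr (star (Ψ g) * g * ρ) = tr (star g * g * ρ) := by
    rw [mul_assoc, mul_assoc, ← hΨ.map_star, hg]
  have h2 : tr (star g * Ψ g * ρ) = tr (star g * g * ρ) := by
    have := congrArg star h1
    rw [← tr_star, ← tr_star] at this
    simpa [mul_assoc, hρ.star_eq, tr_mul_comm ρ] using this
  have h3 := hinv (star g * g)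
  have h4 := (hΨ g).tr_mul_nonneg hρ
  have h5 : tr (star (Ψ g - g) * (Ψ g - g) * ρ)
      = -tr ((Ψ (star g * g) - star (Ψ g) * Ψ g) * ρ) := by
    have e : star (Ψ g - g) * (Ψ g - g) * ρ = star (Ψ g) * Ψ g * ρ - star (Ψ g) * g * ρ
        - star g * Ψ g * ρ + star g * g * ρ := by
      rw [star_sub]; noncomm_ring
    rw [e, tr_add, tr_sub, tr_sub, h1, h2, sub_mul, tr_sub, h3]
    ring
  have h6 := (pos_star_mul_self (Ψ g - g)).tr_mul_nonneg hρ
  have h7 : tr (star (Ψ g - g) * (Ψ g - g) * ρ) = 0 :=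
    le_antisymm (h5 ▸ neg_nonpos.2 h4) h6
  have h8 := (pos_star_mul_self (Ψ g - g)).eq_zero_of_tr_mul hρ hu h7
  exact sub_eq_zero.1 (hs_self_eq_zero (by rw [hs, h8, tr_zero]))

/-- The compression `h` of `ρ` to the fixed point algebra, with its inverse. -/
theorem exists_fixed_density (hΨ : IsUnitalSchwarz Ψ) (hρ : Pos ρ) (hu : IsUnit ρ)
    (hinv : IsInvariant Ψ ρ) : ∃ h k : A, Ψ h = h ∧ Pos h ∧ h * k = 1 ∧ k * h = 1 ∧
      ∀ f, Ψ f = f → tr (h * f) = tr (ρ * f) := by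
  let F := toStarSubalgebra (fixedPoints Ψ) hΨ.1
    (fun a ha b hb => (map_mul_of_fixed hΨ.2 hρ hu hinv hb a).trans (by rw [ha]))
    (fun a ha b hb => (map_add Ψ a b).trans (by rw [ha, hb]))
    (fun c a ha => (map_smul Ψ c a).trans (by rw [ha]))
    (fun a ha => (hΨ.2.map_star a).trans (by rw [ha]))
  have hF : ∀ a : A, (a : Op H) ∈ F ↔ Ψ a = a := fun a => mem_toStarSubalgebra
  have hFA : ∀ x ∈ F, x ∈ A := by
    rintro _ ⟨a, -, rfl⟩
    exact a.2
  -- The adjoint of the inclusion sends ρ to the element of `F` that represents Tr(ρ ·) on `F`.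
  let ι : F →ₗ[ℂ] A :=
    { toFun := fun x => ⟨x, hFA x x.2⟩
      map_add' := fun _ _ => rfl
      map_smul' := fun _ _ => rfl }
  have hι : ∀ x : F, Ψ (ι x) = ι x := fun x => (hF _).1 x.2
  have hιmul : ∀ x y : F, ι (x * y) = ι x * ι y := fun _ _ => rfl
  have hιstar : ∀ x : F, ι (star x) = star (ι x) := fun _ => rfl
  have hι1 : ι 1 = 1 := rfl
  have hι0 : ∀ x : F, ι x = 0 → x = 0 := fun x hx => by
    refine Subtype.ext ?_
    have : (ι x : Op H) = 0 := congrArg (fun a : A => (a : Op H)) hx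
    exact this
  have hpos : Pos (hsAdjoint ι ρ) :=
    pos_of_hsAdjoint_pos (fun p hp => by rw [hsAdjoint_hsAdjoint]; exact hp) ρ hρ
  have htr : ∀ x : F, tr (hsAdjoint ι ρ * x) = tr (ρ * ι x) := fun x => by
    have h1 := hs_hsAdjoint ι ρ x
    rwa [hs, hs, hpos.star_eq, hρ.star_eq] at h1
  -- If `h x = 0`, then Tr(ρ x x*) = 0, hence `x = 0` since ρ is faithful. In finite dimension left
  -- multiplication by `h` is then onto, so `h` is invertible inside `F`.
  have hinj : Function.Injective (LinearMap.mulLeft ℂ (hsAdjoint ι ρ)) := by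
    refine (injective_iff_map_eq_zero _).2 fun x hx => ?_
    have h1 : hsAdjoint ι ρ * x = 0 := hx
    have h2 : tr (star (ι (star x)) * ι (star x) * ρ) = 0 := by
      rw [tr_mul_comm]
      have h3 := htr (x * star x)
      rw [← mul_assoc, h1, zero_mul, tr_zero] at h3
      rw [← hιstar, star_star, ← hιmul, ← h3]
    have h4 := (pos_star_mul_self (ι (star x))).eq_zero_of_tr_mul hρ hu h2
    have h5 : ι (star x) = 0 := hs_self_eq_zero (by rw [hs, h4, tr_zero])
    have h6 : star x = 0 := hι0 _ h5
    rw [← star_star x, h6, star_zero]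
  have := finiteDimensional F
  obtain ⟨k, hk⟩ := LinearMap.injective_iff_surjective.1 hinj 1
  have hk : hsAdjoint ι ρ * k = 1 := hk
  have kh : k * hsAdjoint ι ρ = 1 := hinj (by
    change hsAdjoint ι ρ * (k * hsAdjoint ι ρ) = hsAdjoint ι ρ * 1
    rw [← mul_assoc, hk, one_mul, mul_one])
  refine ⟨ι (hsAdjoint ι ρ), ι k, hι _, hpos, by rw [← hιmul, hk, hι1],
    by rw [← hιmul, kh, hι1], fun f hf => ?_⟩
  exact htr ⟨f, (hF f).2 hf⟩

/-- All positive elements that are invariant under a unital Schwarz map with a faithful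
invariant state are products of a fixed point and one common element of the commutant of the
fixed point algebra. -/
theorem exists_factorization (hΨ : IsUnitalSchwarz Ψ) (hρ : Pos ρ) (hu : IsUnit ρ)
    (hinv : IsInvariant Ψ ρ) : ∃ ρB : A, Pos ρB ∧ IsUnit ρB ∧
      ρB ∈ Set.centralizer (fixedPoints Ψ) ∧
      ∀ σ, Pos σ → IsInvariant Ψ σ → ∃ f, Ψ f = f ∧ Pos f ∧ σ = f * ρB := by
  obtain ⟨h, k, hfix, hpos, hk, kh, htr⟩ := exists_fixed_density hΨ hρ hu hinv
  obtain ⟨r, hr, rh⟩ := isUnit_iff_exists.1 hu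
  have hmul : ∀ a b, Ψ a = a → Ψ b = b → Ψ (a * b) = a * b := fun a b ha hb => by
    rw [map_mul_of_fixed hΨ.2 hρ hu hinv hb, ha]
  -- Conjugation by ρ preserves F: the adjoint of the invariant element `f* ρ` is `ρ f = (ρ f r) ρ`,
  -- again invariant.
  have hθ : ∀ f, Ψ f = f → Ψ (ρ * f * r) = ρ * f * r := fun f hf => by
    refine fixed_of_isInvariant hΨ.2 hρ hu hinv ?_
    have h1 := (isInvariant_of_fixed hΨ.2 hρ hu hinv
      (f := star f) (by rw [hΨ.2.map_star, hf])).star hΨ.2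
    rw [star_mul, star_star, hρ.star_eq] at h1
    rwa [mul_assoc _ r, rh, mul_one]
  -- On F, conjugation by `h` agrees with conjugation by ρ: the difference `u` of the two sides lies
  -- in F and is trace-orthogonal to F, in particular to `star u`.
  have hcomm : ∀ f, Ψ f = f → h * f = ρ * f * r * h := fun f hf => by
    set u := h * f - ρ * f * r * h with hu'
    have hufix : Ψ u = u := by
      rw [hu', map_sub, hmul _ _ hfix hf, hmul _ _ (hθ f hf) hfix]
    have key : ∀ g, Ψ g = g → tr (u * g) = 0 := fun g hg => by
      have e1 : tr (h * f * g) = tr (ρ * f * g) := by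
        rw [mul_assoc, htr _ (hmul _ _ hf hg), mul_assoc]
      have e2 : tr (ρ * f * r * h * g) = tr (ρ * f * g) := by
        rw [mul_assoc _ h, tr_mul_comm, mul_assoc h, htr _ (hmul _ _ hg (hθ f hf)), tr_mul_comm,
          mul_assoc g, tr_mul_comm]
        simp only [mul_assoc, rh, mul_one]
      rw [hu', sub_mul, tr_sub, e1, e2, sub_self]
    have h1 := key (star u) (by rw [hΨ.2.map_star, hufix])
    have h2 : u = 0 := hs_self_eq_zero (by rw [hs, tr_mul_comm, h1])
    exact sub_eq_zero.1 h2
  have hc : ∀ f, Ψ f = f → f * (k * ρ) = k * ρ * f := fun f hf => by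
    have h1 : k * (ρ * f * r * h) * k = f * k := by
      rw [← hcomm f hf, ← mul_assoc, kh, one_mul]
    have h2 : k * ρ * f * r = f * k := by
      rw [← h1]; simp only [mul_assoc, hk, mul_one]
    calc f * (k * ρ) = k * ρ * f * r * ρ := by rw [h2, mul_assoc]
      _ = k * ρ * f := by rw [mul_assoc _ r, rh, mul_one]
  have hkρ : k * ρ = ρ * k := by
    calc k * ρ = k * ρ * h * k := by rw [mul_assoc _ h, hk, mul_one]
      _ = h * (k * ρ) * k := by rw [hc h hfix]
      _ = ρ * k := by rw [← mul_assoc h, hk, one_mul]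
  have hBpos : Pos (k * ρ) := (hpos.inv hk).mul hρ hkρ
  have hB1 : (k * ρ) * (r * h) = 1 := by
    rw [mul_assoc, ← mul_assoc ρ, hr, one_mul, kh]
  have hB2 : (r * h) * (k * ρ) = 1 := by
    rw [mul_assoc, ← mul_assoc h, hk, one_mul, rh]
  refine ⟨k * ρ, hBpos, isUnit_iff_exists.2 ⟨r * h, hB1, hB2⟩, fun f hf => hc f hf,
    fun σ hσ hσinv => ?_⟩
  have hg : Ψ (σ * r) = σ * r :=
    fixed_of_isInvariant hΨ.2 hρ hu hinv (by rwa [mul_assoc, rh, mul_one])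
  have hf := hmul _ _ hg hfix
  have hσf : σ = σ * r * h * (k * ρ) := by
    rw [mul_assoc σ, mul_assoc σ, hB2, mul_one]
  have hcσ : k * ρ * σ = σ * (k * ρ) := by
    conv_lhs => rw [hσf, ← mul_assoc, ← hc _ hf]
    rw [← hσf]
  refine ⟨σ * r * h, hf, ?_, hσf⟩
  rw [mul_assoc]
  refine hσ.mul (hBpos.inv hB1) ?_
  calc σ * (r * h) = r * h * (k * ρ) * σ * (r * h) := by rw [hB2, one_mul]
    _ = r * h * (k * ρ * σ) * (r * h) := by simp only [mul_assoc]
    _ = r * h * σ * ((k * ρ) * (r * h)) := by rw [hcσ]; simp only [mul_assoc]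
    _ = r * h * σ := by rw [hB1, mul_one]

end Factorization

/-! ### Reversibility -/

theorem IsUnitalSchwarz.comp_hsAdjoint {T : A →ₗ[ℂ] B} {R : A →ₗ[ℂ] B}
    (hT : IsUnitalSchwarz (hsAdjoint T)) (hR : IsUnitalSchwarz R) :
    IsUnitalSchwarz (hsAdjoint T ∘ₗ R) := by
  refine ⟨by simp [hR.1, hT.1], fun a => ?_⟩
  have h1 := hT.2.pos _ (hR.2 a)
  have h2 := h1.add (hT.2 (R a))
  rwa [map_sub, sub_add_sub_cancel] at h2

/-- Dual form of the module property T*(b c) = T*(b) T*(c). -/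
theorem map_mul_of_mem_multDomain {T : A →ₗ[ℂ] B} (hT : IsUnitalSchwarz (hsAdjoint T)) {c : B}
    (hc : c ∈ multDomain (hsAdjoint T)) (x : A) : T (hsAdjoint T c * x) = c * T x := by
  refine eq_of_hs fun b => ?_
  have h := hs_hsAdjoint T (star c * b) x
  rw [hs, hs, star_mul, star_star, ← hT.2.map_star, star_mul, star_star,
    (hT.2.mem_multDomain_iff.1 hc).1, hT.2.map_star] at h
  rw [← hs_hsAdjoint, hs, hs, ← mul_assoc, h, mul_assoc]

/-- If `S` recovers the elements of `𝒮`, these factorize along the fixed points of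
`T* ∘ S*`. -/
theorem exists_factorization_of_reverses {T : A →ₗ[ℂ] B} (hT : IsUnitalSchwarz (hsAdjoint T))
    {𝒮 : Set A} (h𝒮 : ∀ σ ∈ 𝒮, Pos σ) {ρ : A} (hρ : ρ ∈ 𝒮) (hu : IsUnit ρ) {S : B →ₗ[ℂ] A}
    (hS : IsUnitalSchwarz (hsAdjoint S)) (hST : ∀ σ ∈ 𝒮, S (T σ) = σ) :
    ∃ ρB : A, Pos ρB ∧ IsUnit ρB ∧
      ρB ∈ Set.centralizer (fixedPoints (hsAdjoint T ∘ₗ hsAdjoint S)) ∧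
      ∀ σ ∈ 𝒮, ∃ c : B, Pos c ∧ c ∈ fixedPoints (hsAdjoint S ∘ₗ hsAdjoint T) ∧
        σ = hsAdjoint T c * ρB ∧ T σ = c * T ρB := by
  have hΨ := hT.comp_hsAdjoint hS
  have hinv : ∀ σ ∈ 𝒮, IsInvariant (hsAdjoint T ∘ₗ hsAdjoint S) σ := fun σ hσ =>
    isInvariant_of_hs hΨ.2 fun a => by
      rw [LinearMap.comp_apply, hs_hsAdjoint, hs_hsAdjoint, hST σ hσ]
  obtain ⟨ρB, hpos, hunit, hcent, hfact⟩ := exists_factorization hΨ (h𝒮 ρ hρ) hu (hinv ρ hρ)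
  refine ⟨ρB, hpos, hunit, hcent, fun σ hσ => ?_⟩
  obtain ⟨f, hf, hfpos, rfl⟩ := hfact σ (h𝒮 σ hσ) (hinv σ hσ)
  have hf' : hsAdjoint T (hsAdjoint S f) = f := hf
  have hcpos := hS.2.pos f hfpos
  -- T*(S*(f* f)) ≥ T*(S*(f)* S*(f)) ≥ T*(S*(f))* T*(S*(f)) has equal ends, so the second inequality
  -- is an equality.
  have hmem : hsAdjoint S f ∈ multDomain (hsAdjoint T) := by
    have h0 := (mem_multDomain_of_fixed hΨ.2 (h𝒮 ρ hρ) hu (hinv ρ hρ) hf).1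
    have h1 := hT.2 (hsAdjoint S f)
    have h2 := hT.2.pos _ (hS.2 f)
    have h3 : hsAdjoint T (star (hsAdjoint S f) * hsAdjoint S f)
        = star (hsAdjoint T (hsAdjoint S f)) * hsAdjoint T (hsAdjoint S f) := by
      refine sub_eq_zero.1 (h1.eq_zero ?_)
      convert h2 using 1
      rw [map_sub, neg_sub]
      congr 1
      exact h0.symm
    refine ⟨h3, ?_⟩
    rwa [hcpos.star_eq, (hT.2.pos _ hcpos).star_eq] at h3 ⊢
  refine ⟨hsAdjoint S f, hcpos, ?_, by rw [hf'], ?_⟩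
  · change hsAdjoint S (hsAdjoint T (hsAdjoint S f)) = hsAdjoint S f
    rw [hf']
  · conv_lhs => rw [← hf', map_mul_of_mem_multDomain hT hmem]

/-! ### Recovery of factorized elements -/

theorem commute_of_pos_mul {a b : A} (ha : Pos a) (hb : Pos b) (hab : Pos (a * b)) :
    a * b = b * a := by
  have := hab.star_eq
  rw [star_mul, ha.star_eq, hb.star_eq] at this
  exact this.symm

/-- By duality `hTs` says exactly that the Schwarz defect of T* at `s` has zero trace against the
faithful `ρB`. -/
theorem mem_multDomain_of_factorization {T : A →ₗ[ℂ] B} (hT : IsUnitalSchwarz (hsAdjoint T))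
    {ρB : A} (hρB : Pos ρB) (hu : IsUnit ρB) {s : B} (hs' : Pos s)
    (hTs : T (hsAdjoint T s * ρB) = s * T ρB) : s ∈ multDomain (hsAdjoint T) := by
  have h1 : hsAdjoint T (star s * s) = star (hsAdjoint T s) * hsAdjoint T s := by
    refine sub_eq_zero.1 ((hT.2 s).eq_zero_of_tr_mul hρB hu ?_)
    have e1 := hs_hsAdjoint T (star s * s) ρB
    have e2 := hs_hsAdjoint T s (hsAdjoint T s * ρB)
    rw [hs, hs, ← hT.2.map_star, star_mul, star_star] at e1
    rw [hs, hs, hTs, ← mul_assoc, ← mul_assoc] at e2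
    rw [sub_mul, tr_sub, e1, e2, sub_self]
  refine ⟨h1, ?_⟩
  rwa [hs'.star_eq, (hT.2.pos _ hs').star_eq] at h1 ⊢

theorem tr_mul_mul_mul (r x y : A) : tr (r * (x * r) * y) = tr (x * (r * y * r)) := by
  rw [mul_assoc r, tr_mul_comm r]
  simp only [mul_assoc]

theorem hsAdjoint_dualMap (T : A →ₗ[ℂ] B) (ρ : A) (b : B) :
    hsAdjoint (dualMap T ρ) b = rpow ρ (1 / 2) *
      hsAdjoint T (rpow (T ρ) (-1 / 2) * b * rpow (T ρ) (-1 / 2)) * rpow ρ (1 / 2) := by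
  have h : LinearMap.mulLeftRight ℂ (rpow ρ (1 / 2), rpow ρ (1 / 2)) ∘ₗ hsAdjoint T ∘ₗ
      LinearMap.mulLeftRight ℂ (rpow (T ρ) (-1 / 2), rpow (T ρ) (-1 / 2))
      = hsAdjoint (dualMap T ρ) := by
    refine hsAdjoint_unique _ _ fun b a => ?_
    have e := hs_hsAdjoint T (rpow (T ρ) (-1 / 2) * b * rpow (T ρ) (-1 / 2))
      (rpow ρ (1 / 2) * a * rpow ρ (1 / 2))
    have hn := (pos_rpow (T ρ) (-1 / 2)).star_eq
    have hr := (pos_rpow ρ (1 / 2)).star_eq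
    simp only [dualMap, LinearMap.comp_apply, LinearMap.mulLeftRight_apply]
    generalize rpow (T ρ) (-1 / 2) = n at *
    generalize rpow ρ (1 / 2) = r at *
    simp only [hs, star_mul, hn, hr] at e ⊢
    rw [tr_mul_mul_mul, e, tr_mul_mul_mul]
  rw [← h]
  simp only [LinearMap.comp_apply, LinearMap.mulLeftRight_apply]

/-- The transpose of the dual map recovers every element with a factorization. -/
theorem hsAdjoint_dualMap_apply {T : A →ₗ[ℂ] B} (hT : IsUnitalSchwarz (hsAdjoint T)) {ρ σ ρB : A}
    (hρ : Pos ρ) (hTu : IsUnit (T ρ)) (hσ : Pos σ) (hρB : Pos ρB) (hu : IsUnit ρB)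
    {r s : B} (hr : Pos r) (hs' : Pos s) (hρr : ρ = hsAdjoint T r * ρB)
    (hTr : T ρ = r * T ρB) (hσs : σ = hsAdjoint T s * ρB) (hTs : T σ = s * T ρB) :
    hsAdjoint (dualMap T ρ) (T σ) = σ := by
  have hTpos := pos_of_hsAdjoint_pos hT.2.pos
  have hΘr := hT.2.pos _ hr
  have hrmem := mem_multDomain_of_factorization hT hρB hu hr (hρr ▸ hTr)
  have hqmem := hT.2.mem_multDomain_iff.1 (hT.rpow_mem_multDomain hrmem (1 / 2))
  have hqq := rpow_half_mul_self hr
  have hqpos := pos_rpow r (1 / 2)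
  have hvv := rpow_half_mul_self hρB
  have hvpos := pos_rpow ρB (1 / 2)
  have hww := rpow_half_mul_self (hTpos _ hρB)
  have hwpos := pos_rpow (T ρB) (1 / 2)
  have c1 := commute_of_pos_mul hΘr hρB (hρr ▸ hρ)
  have c2 := commute_of_pos_mul hr (hTpos _ hρB) (hTr ▸ hTpos _ hρ)
  have c3 := commute_of_pos_mul (hT.2.pos _ hs') hρB (hσs ▸ hσ)
  have c4 := commute_of_pos_mul hs' (hTpos _ hρB) (hTs ▸ hTpos _ hσ)
  have hΘq : hsAdjoint T (rpow r (1 / 2)) = rpow (hsAdjoint T r) (1 / 2) :=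
    eq_rpow_half (by rw [← hqmem.1, hqq]) (hT.2.pos _ hqpos)
  have d1 : hsAdjoint T (rpow r (1 / 2)) * rpow ρB (1 / 2)
      = rpow ρB (1 / 2) * hsAdjoint T (rpow r (1 / 2)) := by
    rw [hΘq]
    exact rpow_half_commute (rpow_half_commute c1.symm).symm
  have d2 : rpow r (1 / 2) * rpow (T ρB) (1 / 2) = rpow (T ρB) (1 / 2) * rpow r (1 / 2) :=
    rpow_half_commute (rpow_half_commute c2.symm).symm
  have d3 := rpow_half_commute c3.symm
  have d4 := rpow_half_commute c4.symm
  -- The factorizations of ρ and Tρ have commuting factors, so they pass to square roots.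
  have f1 : hsAdjoint T (rpow r (1 / 2)) * rpow ρB (1 / 2) = rpow ρ (1 / 2) := by
    refine eq_rpow_half ?_ ((hT.2.pos _ hqpos).mul hvpos d1)
    rw [Commute.mul_mul_mul_comm d1.symm, ← hqmem.1, hqq, hvv, ← hρr]
  have f2 : rpow r (1 / 2) * rpow (T ρB) (1 / 2) = rpow (T ρ) (1 / 2) := by
    refine eq_rpow_half ?_ (hqpos.mul hwpos d2)
    rw [Commute.mul_mul_mul_comm d2.symm, hqq, hww, ← hTr]
  have n1 := rpow_neg_half_mul (hTpos _ hρ) hTu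
  have n2 := mul_rpow_neg_half (hTpos _ hρ) hTu
  rw [hsAdjoint_dualMap, hTs, ← f1]
  rw [← f2] at n1 n2
  generalize rpow (T ρ) (-1 / 2) = n at *
  generalize rpow r (1 / 2) = q at *
  generalize rpow ρB (1 / 2) = v at *
  generalize rpow (T ρB) (1 / 2) = w at *
  have hnq : n * q = q * n := by
    calc n * q = n * q * (w * q * n) := by rw [← d2, n2, mul_one]
      _ = n * (q * w) * (q * n) := by simp only [mul_assoc]
      _ = q * n := by rw [n1, one_mul]
  have h1 : q * n * w = 1 := by rw [← hnq, mul_assoc, n1]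
  have h2 : w * n * q = 1 := by rw [mul_assoc, hnq, ← mul_assoc, ← d2, n2]
  -- T*(q) can be moved inside T*, since `q` is in the multiplicative domain. There it cancels the
  -- factors `n` and turns Tσ back into `s`.
  have h3 : q * (n * (s * T ρB) * n) * q = s := by
    calc q * (n * (s * T ρB) * n) * q = q * n * (s * w) * (w * n * q) := by
          rw [← hww]; simp only [mul_assoc]
      _ = (q * n * w) * s := by rw [← d4, h2, mul_one, ← mul_assoc]
      _ = s := by rw [h1, one_mul]
  calc hsAdjoint T q * v * hsAdjoint T (n * (s * T ρB) * n) * (hsAdjoint T q * v)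
      = v * (hsAdjoint T q * hsAdjoint T (n * (s * T ρB) * n) * hsAdjoint T q) * v := by
        refine (congrArg (fun z => z * hsAdjoint T (n * (s * T ρB) * n) *
          (hsAdjoint T q * v)) d1).trans ?_
        simp only [mul_assoc]
    _ = v * hsAdjoint T s * v := by rw [← hqmem.2, ← hqmem.1, h3]
    _ = σ := by rw [d3, mul_assoc, hvv, hσs]

end

end Reversibility

open Reversibility in
theorem theorem4 {H K : Type*}
    [NormedAddCommGroup H] [InnerProductSpace ℂ H] [FiniteDimensional ℂ H] [CompleteSpace H]
    [NormedAddCommGroup K] [InnerProductSpace ℂ K] [FiniteDimensional ℂ K] [CompleteSpace K]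
    (A : StarSubalgebra ℂ (Op H)) (B : StarSubalgebra ℂ (Op K))
    (T : A →ₗ[ℂ] B) (𝒮 : Set A) (h𝒮 : ∀ σ ∈ 𝒮, IsDensity σ)
    (ρ : A) (hρ : ρ ∈ 𝒮) (hρ_inv : IsUnit ρ) (hTρ_inv : IsUnit (T ρ))
    (hT : IsUnitalSchwarz (hsAdjoint T)) (hTρ : IsUnitalSchwarz (dualMap T ρ)) :
    List.TFAE [
      IsReversible T 𝒮,
      ∃ ρB : A, Pos ρB ∧ IsUnit ρB ∧
        ρB ∈ Set.centralizer (fixedPoints (hsAdjoint T ∘ₗ dualMap T ρ)) ∧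
        ∀ σ ∈ 𝒮, ∃ σ₀A : B, Pos σ₀A ∧ σ₀A ∈ fixedPoints (dualMap T ρ ∘ₗ hsAdjoint T) ∧
          σ = hsAdjoint T σ₀A * ρB ∧ T σ = σ₀A * T ρB,
      ∃ ρB : A, Pos ρB ∧
        ∀ σ ∈ 𝒮, ∃ σ₀A : B, Pos σ₀A ∧ σ = hsAdjoint T σ₀A * ρB ∧ T σ = σ₀A * T ρB,
      ∃ ρB : A, Pos ρB ∧
        ∀ σ ∈ 𝒮, ∃ σA : A, Pos σA ∧ σA ∈ hsAdjoint T '' multDomain (hsAdjoint T) ∧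
          σ = σA * ρB] := by
  have hpos : ∀ σ ∈ 𝒮, Pos σ := fun σ hσ => (h𝒮 σ hσ).1
  have hTpos := pos_of_hsAdjoint_pos hT.2.pos
  have hunit : ∀ ρB : A, Pos ρB → ∀ a : A, Pos a → ρ = a * ρB → IsUnit ρB := by
    intro ρB hρB a ha h
    have hc := commute_of_pos_mul ha hρB (h ▸ hpos ρ hρ)
    exact ((Commute.isUnit_mul_iff hc).1 (h ▸ hρ_inv)).2
  have hrec : (∃ ρB : A, Pos ρB ∧ ∀ σ ∈ 𝒮, ∃ σ₀A : B, Pos σ₀A ∧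
      σ = hsAdjoint T σ₀A * ρB ∧ T σ = σ₀A * T ρB) →
      ∀ σ ∈ 𝒮, hsAdjoint (dualMap T ρ) (T σ) = σ := by
    rintro ⟨ρB, hρB, h⟩ σ hσ
    obtain ⟨r, hr, hρr, hTr⟩ := h ρ hρ
    obtain ⟨s, hs', hσs, hTs⟩ := h σ hσ
    exact hsAdjoint_dualMap_apply hT (hpos ρ hρ) hTρ_inv (hpos σ hσ) hρB
      (hunit ρB hρB _ (hT.2.pos _ hr) hρr) hr hs' hρr hTr hσs hTs
  have hdual := hsAdjoint_hsAdjoint (dualMap T ρ)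
  tfae_have 1 → 3 := by
    rintro ⟨S, hS, hST⟩
    obtain ⟨ρB, hρB, -, -, h⟩ := exists_factorization_of_reverses hT hpos hρ hρ_inv hS hST
    refine ⟨ρB, hρB, fun σ hσ => ?_⟩
    obtain ⟨c, hc, -, h1, h2⟩ := h σ hσ
    exact ⟨c, hc, h1, h2⟩
  tfae_have 3 → 1 := fun h => ⟨hsAdjoint (dualMap T ρ), by rwa [hdual], hrec h⟩
  -- With the adjoint of T_ρ as the reversing map, T*∘S* and S*∘T* become Φ and its counterpart on
  -- `B`, as (ii) requires.
  tfae_have 3 → 2 := fun h => by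
    obtain ⟨ρB, h⟩ := exists_factorization_of_reverses hT hpos hρ hρ_inv
      (S := hsAdjoint (dualMap T ρ)) (by rwa [hdual]) (hrec h)
    rw [hdual] at h
    exact ⟨ρB, h⟩
  tfae_have 2 → 3 := by
    rintro ⟨ρB, hρB, -, -, h⟩
    refine ⟨ρB, hρB, fun σ hσ => ?_⟩
    obtain ⟨c, hc, -, h1, h2⟩ := h σ hσ
    exact ⟨c, hc, h1, h2⟩
  tfae_have 3 → 4 := by
    rintro ⟨ρB, hρB, h⟩
    obtain ⟨r, hr, hρr, -⟩ := h ρ hρ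
    have hu := hunit ρB hρB _ (hT.2.pos _ hr) hρr
    refine ⟨ρB, hρB, fun σ hσ => ?_⟩
    obtain ⟨s, hs', hσs, hTs⟩ := h σ hσ
    exact ⟨hsAdjoint T s, hT.2.pos _ hs',
      ⟨s, mem_multDomain_of_factorization hT hρB hu hs' (hσs ▸ hTs), rfl⟩, hσs⟩
  tfae_have 4 → 3 := by
    rintro ⟨ρB, hρB, h⟩
    refine ⟨ρB, hρB, fun σ hσ => ?_⟩
    obtain ⟨_, ha, ⟨c, hc, rfl⟩, hσc⟩ := h σ hσ
    -- T* is faithful because Tr(p Tρ) = Tr(T*(p) ρ) and Tρ is invertible, so positivity of T*(c)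
    -- lifts to `c`.
    refine ⟨c, hT.pos_of_pos_map (fun p hp h0 => ?_) hc ha, hσc, ?_⟩
    · refine hp.eq_zero_of_tr_mul (hTpos ρ (hpos ρ hρ)) hTρ_inv ?_
      have h1 := hs_hsAdjoint T p ρ
      rw [h0, hs, hs, star_zero, zero_mul, tr_zero, hp.star_eq] at h1
      exact h1.symm
    · rw [hσc, map_mul_of_mem_multDomain hT hc]
  tfae_finish
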